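/- Let $K$ be a field. A curve over $K$ is a nonsingular, projective, geometrically irreducible one-dimensional variety over $K$, and a cover is a nonconstant separable morphism (over $K$) between curves over $K$; its degree is the degree of the corresponding extension of function fields. For a cover $\phi\colon C\to D$, the monodromy group $\mathrm{Mon}(\phi)$ is the Galois group of the Galois closure of $K(C)/K(D)$, viewed as a group of permutations of the set of $K(D)$-embeddings of $K(C)$ into an algebraic closure of $K(D)$, and $\mathrm{Aut}(\phi)$ is the group of automorphisms $\mu$ of $C$ defined over $K$ with $\phi\circ\mu=\phi$. A Dedekind group is a group all of whose subgroups are normal. Theorem. Let $\phi\colon C\to D$ be a cover of curves over $K$ such that $\mathrm{Mon}(\phi)$ has a transitive Dedekind subgroup. Let $\phi=\phi_n\circ\phi_{n-1}\circ\dots\circ\phi_1$ be a decomposition of $\phi$, that is, each $\phi_i\colon C_{i-1}\to C_i$ is a cover of curves over $K$ of degree at least $2$, with $C_0=C$ and $C_n=D$. For $1\le i\le n$ write $\psi_i:=\phi_i\circ\phi_{i-1}\circ\dots\circ\phi_1$. Then for each $i$ with $1\le i<n$ the group $\mathrm{Aut}(\psi_i)$ is a normal subgroup of $\mathrm{Aut}(\psi_{i+1})$,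 and the quotient group $\mathrm{Aut}(\psi_{i+1})/\mathrm{Aut}(\psi_i)$ is isomorphic to a subgroup of $\mathrm{Aut}(\phi_{i+1})$. In particular, the groups $\mathrm{Aut}(\phi)$ and $\mathrm{Aut}(\phi_i)$ are finite and $$|\mathrm{Aut}(\phi)|\ \text{ divides }\ \prod_{i=1}^n|\mathrm{Aut}(\phi_i)|.$$ -/

import Mathlib

open CategoryTheory AlgebraicGeometry

universe u

noncomputable section

/-! ### Curves -/

/-- Projective space of dimension `n` over a field `K`, as `Proj K[x₀, …, xₙ]`. -/
def projectiveSpaceOver (K : Type u) [Field K] (n : ℕ) :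
    Over (Spec (CommRingCat.of K)) :=
  letI : GradedAlgebra (MvPolynomial.homogeneousSubmodule (Fin (n + 1)) K) :=
    MvPolynomial.gradedAlgebra
  Over.mk (Proj.toSpecZero (MvPolynomial.homogeneousSubmodule (Fin (n + 1)) K) ≫
    Spec.map (CommRingCat.ofHom
      (algebraMap K (MvPolynomial.homogeneousSubmodule (Fin (n + 1)) K 0))))

/-- A curve over a field `K`: a nonsingular (all local rings are regular), projective,
geometrically irreducible one-dimensional variety over `K`. -/
class IsCurve {K : Type u} [Field K] (X : Over (Spec (CommRingCat.of K))) : Prop where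
  isIntegral : IsIntegral X.left
  geometricallyIrreducible : GeometricallyIrreducible X.hom
  nonsingular : ∀ x : X.left, IsRegularLocalRing (X.left.presheaf.stalk x)
  projective : ∃ (n : ℕ) (ι : X ⟶ projectiveSpaceOver K n), IsClosedImmersion ι.left
  one_dimensional : topologicalKrullDim X.left = 1

attribute [instance] IsCurve.isIntegral

/-! ### Nonconstant morphisms and the induced extension of function fields -/

section Covers

variable {K : Type u} [Field K] {X Y : Over (Spec (CommRingCat.of K))}

/-- A morphism is nonconstant if its image is not a single point. -/
class IsNonconstant (f : X ⟶ Y) : Prop where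
  nonconstant : ¬ ∃ y : Y.left, ∀ x : X.left, f.left x = y

/-- A nonconstant morphism of curves maps the generic point to the generic point. -/
theorem map_genericPoint_specializes [IsCurve X] [IsCurve Y] (f : X ⟶ Y) [hf : IsNonconstant f] :
    f.left (genericPoint X.left) ⤳ genericPoint Y.left := by
  by_contra hne
  apply hf.nonconstant
  refine ⟨f.left (genericPoint X.left), fun x => ?_⟩
  have hx : f.left (genericPoint X.left) ⤳ f.left x :=
    ((genericPoint_spec X.left).specializes trivial).map f.left.continuous
  by_contra hxy
  let c : Y.left → TopologicalSpace.IrreducibleCloseds Y.left := fun y =>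
    ⟨closure {y}, isIrreducible_singleton.closure, isClosed_closure⟩
  have hlt : ∀ a b : Y.left, a ⤳ b → ¬ b ⤳ a → c b < c a := by
    intro a b hab hba
    refine lt_of_le_of_ne (specializes_iff_closure_subset.mp hab) fun h => hba ?_
    rw [specializes_iff_closure_subset]
    exact (congrArg (fun Z : TopologicalSpace.IrreducibleCloseds Y.left => (Z : Set Y.left))
      h).ge
  have h1 : c (f.left x) < c (f.left (genericPoint X.left)) :=
    hlt _ _ hx fun h => hxy (h.antisymm hx).eq
  have h2 : c (f.left (genericPoint X.left)) < c (genericPoint Y.left) :=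
    hlt _ _ ((genericPoint_spec Y.left).specializes trivial) hne
  have hd := IsCurve.one_dimensional (X := Y)
  have hs : ((2 : ℕ) : WithBot ℕ∞) ≤ _ := Order.le_krullDim_iff.mpr
    ⟨(⟨2, ![c (f.left x), c (f.left (genericPoint X.left)), c (genericPoint Y.left)], fun i => by fin_cases i; exacts [h1, h2]⟩ :
      LTSeries (TopologicalSpace.IrreducibleCloseds Y.left)), rfl⟩
  rw [← topologicalKrullDim, hd] at hs
  exact absurd hs (by norm_num)

variable [IsCurve X] [IsCurve Y] (f : X ⟶ Y) [IsNonconstant f]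

/-- The homomorphism `K(Y) → K(X)` of function fields, `h ↦ h ∘ f`, induced by a nonconstant
morphism of curves `f : X ⟶ Y`. -/
def functionFieldMap : Y.left.functionField →+* X.left.functionField :=
  (Y.left.presheaf.stalkSpecializes (map_genericPoint_specializes f) ≫
    f.left.stalkMap (genericPoint X.left)).hom

/-- The structure of `K(X)` as an extension of `K(Y)`. -/
abbrev functionFieldAlgebra : Algebra Y.left.functionField X.left.functionField :=
  (functionFieldMap f).toAlgebra

/-- The degree `[K(X) : K(Y)]` of a nonconstant morphism of curves `f : X ⟶ Y`. -/
def coverDegree : ℕ :=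
  letI := functionFieldAlgebra f
  Module.finrank Y.left.functionField X.left.functionField

end Covers

/-- A cover of curves: a nonconstant separable morphism, that is, one for which `K(X)` is a
separable algebraic extension of `K(Y)`. -/
class IsCover {K : Type u} [Field K] {X Y : Over (Spec (CommRingCat.of K))}
    [IsCurve X] [IsCurve Y] (f : X ⟶ Y) : Prop extends IsNonconstant f where
  separable :
    letI := functionFieldAlgebra f
    Algebra.IsSeparable Y.left.functionField X.left.functionField

/-! ### The monodromy group -/

section Monodromy

variable (F E : Type u) [Field F] [Field E] [Algebra F E]

/-- The Galois group of the Galois closure (inside an algebraic closure of `F`) of an extension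
`E / F`. -/
abbrev GaloisClosureGroup : Type u :=
  IntermediateField.normalClosure F E (AlgebraicClosure F) ≃ₐ[F]
    IntermediateField.normalClosure F E (AlgebraicClosure F)

/-- The group of the Galois closure acts by composition on the set of `F`-embeddings of `E` into
an algebraic closure of `F`; all these embeddings have their image in the Galois closure. -/
instance galoisClosureAction :
    MulAction (GaloisClosureGroup F E) (E →ₐ[F] AlgebraicClosure F) where
  smul σ s := normalClosure.algHomEquiv F E (AlgebraicClosure F)
    ((σ : IntermediateField.normalClosure F E (AlgebraicClosure F) →ₐ[F]
      IntermediateField.normalClosure F E (AlgebraicClosure F)).comp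
        ((normalClosure.algHomEquiv F E (AlgebraicClosure F)).symm s))
  one_smul _ := rfl
  mul_smul _ _ _ := rfl

/-- A Dedekind group is a group all of whose subgroups are normal. -/
def IsDedekindGroup (A : Type*) [Group A] : Prop := ∀ B : Subgroup A, B.Normal

/-- The group of the Galois closure of `E / F`, viewed as a group of permutations of the set of
`F`-embeddings of `E` into an algebraic closure of `F`, has a transitive Dedekind subgroup. -/
def GaloisClosureGroup.HasTransitiveDedekindSubgroup : Prop :=
  ∃ A : Subgroup (GaloisClosureGroup F E),
    IsDedekindGroup A ∧ MulAction.IsPretransitive A (E →ₐ[F] AlgebraicClosure F)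

end Monodromy

/-- The monodromy group of a cover of curves `f : X ⟶ Y`, that is, the Galois group of the Galois
closure of `K(X) / K(Y)`, acting on the set of `K(Y)`-embeddings of `K(X)` into an algebraic
closure of `K(Y)`, has a transitive Dedekind subgroup. -/
def MonHasTransitiveDedekindSubgroup {K : Type u} [Field K]
    {X Y : Over (Spec (CommRingCat.of K))} [IsCurve X] [IsCurve Y] (f : X ⟶ Y) [IsCover f] :
    Prop :=
  letI := functionFieldAlgebra f
  GaloisClosureGroup.HasTransitiveDedekindSubgroup Y.left.functionField X.left.functionField

/-! ### Automorphism groups of covers, and compositions -/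

/-- The group `Aut(f)` of all automorphisms `μ` of `X` (defined over `K`) with `f ∘ μ = f`. -/
def coverAut {K : Type u} [Field K] {X Y : Over (Spec (CommRingCat.of K))} (f : X ⟶ Y) :
    Subgroup (Aut X) where
  carrier := {μ | μ.hom ≫ f = f}
  one_mem' := Category.id_comp f
  mul_mem' {μ ν} hμ hν := by
    change (ν.hom ≫ μ.hom) ≫ f = f
    rw [Category.assoc, show μ.hom ≫ f = f from hμ]
    exact hν
  inv_mem' {μ} hμ := by
    exact (Iso.inv_comp_eq (show X ≅ X from μ)).mpr (Eq.symm hμ)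

/-- For a chain `C₀ → C₁ → ⋯ → Cₙ` with maps `φ 0, …, φ (n - 1)`, the composite
`C₀ ⟶ Cᵢ` of the first `i` maps (the identity for `i = 0`). -/
def partialComp {K : Type u} [Field K] {n : ℕ} {C : Fin (n + 1) → Over (Spec (CommRingCat.of K))}
    (φ : ∀ i : Fin n, C i.castSucc ⟶ C i.succ) (i : Fin (n + 1)) : C 0 ⟶ C i :=
  Fin.induction (motive := fun i => C 0 ⟶ C i) (𝟙 (C 0)) (fun i ψ => ψ ≫ φ i) i

end

/-! Put F = K(D), E = K(C), and let A be the transitive Dedekind subgroup. The key point is that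
every F-endomorphism σ of E maps each intermediate field M into itself. Fix an embedding s; by
transitivity s ∘ σ = a ∘ s with a in A. The pointwise stabilizer B of s(M) in A is normal, so B also
fixes s(σ(M)). By transitivity and separability, the elements of s(E) fixed by B are exactly those
of s(M), whence σ(M) ⊆ M. An automorphism of ψ_{i+1} is one of φ, so it preserves K(C_i). Since
curves are regular and proper, the restriction to K(C_i) comes from a morphism of C_i
(`IsCurve.exists_hom_of_functionField`). This gives a homomorphism Aut(ψ_{i+1}) → Aut(φ_{i+1}) with
kernel Aut(ψ_i) (`exists_coverAut_hom`); normality, the embedding of the quotient and, by induction,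
the divisibility follow. -/

noncomputable section

/-! ### Field theory: embeddings and the transitive Dedekind subgroup -/

/-- An element of a separable extension `E / F` outside an intermediate field `M` is moved by
some `M`-conjugate of a given embedding of `E` into an algebraically closed field. -/
theorem IntermediateField.exists_algHom_ne_of_notMem {F E Ω : Type*} [Field F] [Field E] [Field Ω]
    [Algebra F E] [Algebra F Ω] [IsAlgClosed Ω] [Algebra.IsSeparable F E]
    (M : IntermediateField F E) (s : E →ₐ[F] Ω) {x : E} (hx : x ∉ M) :
    ∃ t : E →ₐ[F] Ω, (∀ m ∈ M, t m = s m) ∧ t x ≠ s x := by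
  -- With Ω an M-algebra through s, the M-embeddings of E are the t agreeing with s on M. By
  -- separability the minimal polynomial of x has a root other than s x, to which x can be sent.
  let : Algebra M Ω := (s.comp M.val).toRingHom.toAlgebra
  have : IsScalarTower F M Ω := .of_algebraMap_eq fun r => ((s.comp M.val).commutes r).symm
  have : Algebra.IsSeparable M E := Algebra.isSeparable_tower_top_of_isSeparable F M E
  have hint (y : E) : IsIntegral M y := Algebra.IsIntegral.isIntegral y
  have hdeg : 2 ≤ (minpoly M x).natDegree :=
    (minpoly.two_le_natDegree_iff (hint x)).mpr fun ⟨m, hm⟩ => hx (hm ▸ m.2)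
  have hcard : Fintype.card ((minpoly M x).rootSet Ω) = (minpoly M x).natDegree :=
    Polynomial.card_rootSet_eq_natDegree (Algebra.IsSeparable.isSeparable M x)
      (IsAlgClosed.splits _)
  obtain ⟨⟨y, hy⟩, hne⟩ := Fintype.exists_ne_of_one_lt_card
    (show 1 < Fintype.card ((minpoly M x).rootSet Ω) by omega)
    ⟨s x, by
      rw [Polynomial.mem_rootSet]
      refine ⟨minpoly.ne_zero (hint x), ?_⟩
      let s' : E →ₐ[M] Ω := { s with commutes' := fun _ => rfl }
      change Polynomial.aeval (s' x) _ = 0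
      rw [Polynomial.aeval_algHom_apply, minpoly.aeval, map_zero]⟩
  obtain ⟨t, ht⟩ := IntermediateField.exists_algHom_of_splits_of_aeval
    (fun z : E => ⟨hint z, IsAlgClosed.splits _⟩) (Polynomial.aeval_eq_zero_of_mem_rootSet hy)
  exact ⟨t.restrictScalars F, fun m hm => t.commutes ⟨m, hm⟩, fun h =>
    hne (Subtype.ext (ht.symm.trans h))⟩

section Monodromy

variable {F E : Type u} [Field F] [Field E] [Algebra F E]

/-- If the group of the Galois closure of `E / F` has a transitive Dedekind subgroup, then every
`F`-endomorphism of `E` preserves every intermediate field. -/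
theorem GaloisClosureGroup.HasTransitiveDedekindSubgroup.map_mem [Algebra.IsSeparable F E]
    (h : GaloisClosureGroup.HasTransitiveDedekindSubgroup F E) (M : IntermediateField F E)
    (σ : E →ₐ[F] E) {x : E} (hx : x ∈ M) : σ x ∈ M := by
  obtain ⟨A, hA, htrans⟩ := h
  let s : E →ₐ[F] AlgebraicClosure F := IsAlgClosed.lift
  let j := (normalClosure.algHomEquiv F E (AlgebraicClosure F)).symm s
  have hj (y : E) : (j y : AlgebraicClosure F) = s y := rfl
  let B : Subgroup A := (M.map j).fixingSubgroup.subgroupOf A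
  have hB : B.Normal := hA B
  obtain ⟨a, ha⟩ := htrans.exists_smul_eq s (s.comp σ)
  have haj (y : E) : (a : GaloisClosureGroup F E) (j y) = j (σ y) :=
    Subtype.ext (DFunLike.congr_fun ha y)
  by_contra hσx
  obtain ⟨t, htM, htx⟩ := M.exists_algHom_ne_of_notMem s hσx
  obtain ⟨b, hb⟩ := htrans.exists_smul_eq s t
  have hbj (y : E) : ((b : GaloisClosureGroup F E) (j y) : AlgebraicClosure F) = t y :=
    DFunLike.congr_fun hb y
  have hbB : b ∈ B := by
    rw [Subgroup.mem_subgroupOf, IntermediateField.mem_fixingSubgroup_iff]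
    rintro _ ⟨m, hm, rfl⟩
    exact Subtype.ext ((hbj m).trans (htM m hm))
  -- a⁻¹ba fixes s(x), so b fixes a(s(x)) = s(σ x); but b sends s(σ x) to t(σ x).
  have hconj := hB.conj_mem b hbB a⁻¹
  rw [Subgroup.mem_subgroupOf, IntermediateField.mem_fixingSubgroup_iff] at hconj
  have hfix := hconj (j x) ⟨x, hx, rfl⟩
  apply htx
  rw [← hbj, ← hj, ← haj]
  congr 1
  simpa using congrArg (a : GaloisClosureGroup F E) hfix

end Monodromy

/-! ### Properness of projective space and of curves -/

instance isProper_projectiveSpaceOver (K : Type u) [Field K] (n : ℕ) :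
    IsProper (projectiveSpaceOver K n).hom := by
  let : GradedAlgebra (MvPolynomial.homogeneousSubmodule (Fin (n + 1)) K) :=
    MvPolynomial.gradedAlgebra
  have : IsScalarTower K (MvPolynomial.homogeneousSubmodule (Fin (n + 1)) K 0)
      (MvPolynomial (Fin (n + 1)) K) :=
    ⟨fun k a b => smul_mul_assoc k (a : MvPolynomial (Fin (n + 1)) K) b⟩
  have : Algebra.FiniteType (MvPolynomial.homogeneousSubmodule (Fin (n + 1)) K 0)
      (MvPolynomial (Fin (n + 1)) K) :=
    Algebra.FiniteType.of_restrictScalars_finiteType K _ _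
  -- Homogeneous polynomials of degree 0 are constants.
  have : IsClosedImmersion (Spec.map (CommRingCat.ofHom
      (algebraMap K (MvPolynomial.homogeneousSubmodule (Fin (n + 1)) K 0)))) := by
    apply IsClosedImmersion.spec_of_surjective
    rintro ⟨p, hp⟩
    have hp' : p.totalDegree = 0 := by
      simpa using ((MvPolynomial.mem_homogeneousSubmodule 0 p).mp hp).totalDegree_le
    rw [MvPolynomial.totalDegree_eq_zero_iff_eq_C] at hp'
    exact ⟨_, Subtype.ext hp'.symm⟩
  change IsProper (Proj.toSpecZero (MvPolynomial.homogeneousSubmodule (Fin (n + 1)) K) ≫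
    Spec.map (CommRingCat.ofHom
      (algebraMap K (MvPolynomial.homogeneousSubmodule (Fin (n + 1)) K 0))))
  infer_instance

variable {K : Type u} [Field K] {X Y Z : Over (Spec (CommRingCat.of K))}

instance IsCurve.isProper [IsCurve X] : IsProper X.hom := by
  obtain ⟨n, ι, hι⟩ := IsCurve.projective (X := X)
  rw [← Over.w ι]
  infer_instance

instance IsCurve.isSeparated_left [IsCurve X] : X.left.IsSeparated :=
  ⟨by
    rw [← Limits.terminal.comp_from X.hom]
    infer_instance⟩

/-! ### Local rings of curves -/

theorem IsCurve.ringKrullDim_stalk_le [IsCurve X] (x : X.left) :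
    ringKrullDim (X.left.presheaf.stalk x) ≤ 1 := by
  rw [← PrimeSpectrum.topologicalKrullDim_eq_ringKrullDim, ← IsCurve.one_dimensional (X := X)]
  exact (X.left.fromSpecStalk x).isEmbedding.isInducing.topologicalKrullDim_le

/-- Regularity in dimension at most 1 bounds the cotangent space by dimension 1; for a Noetherian
local domain this characterizes discrete valuation rings and fields. -/
instance IsCurve.valuationRing_stalk [IsCurve X] (x : X.left) :
    ValuationRing (X.left.presheaf.stalk x) := by
  have := IsCurve.nonsingular x
  have h : ((Module.finrank (IsLocalRing.ResidueField (X.left.presheaf.stalk x))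
      (IsLocalRing.CotangentSpace (X.left.presheaf.stalk x)) : ℕ) : WithBot ℕ∞) ≤ (1 : ℕ) := by
    rw [(IsRegularLocalRing.iff_finrank_cotangentSpace _).mp this]
    exact IsCurve.ringKrullDim_stalk_le x
  exact ((tfae_of_isNoetherianRing_of_isLocalRing_of_isDomain
    (X.left.presheaf.stalk x)).out 5 1).mp (by exact_mod_cast h)

/-! ### Morphisms of curves and their restrictions to the generic point -/

instance IsCurve.isDominant_fromSpecStalk_genericPoint [IsCurve X] :
    IsDominant (X.left.fromSpecStalk (genericPoint X.left)) where
  denseRange := by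
    rw [DenseRange, Scheme.range_fromSpecStalk]
    refine Dense.mono (s₁ := {genericPoint X.left}) ?_ ?_
    · rintro _ rfl
      exact specializes_rfl
    · rw [dense_iff_closure_eq]
      exact genericPoint_spec X.left

/-- A morphism of curves is determined by its restriction to the generic point. -/
theorem IsCurve.hom_ext [IsCurve X] [IsCurve Y] {f g : X ⟶ Y}
    (h : X.left.fromSpecStalk (genericPoint X.left) ≫ f.left =
      X.left.fromSpecStalk (genericPoint X.left) ≫ g.left) : f = g := by
  ext1
  exact ext_of_isDominant _ h

theorem AlgebraicGeometry.Scheme.PartialMap.specMap_stalkSpecializes_fromSpecStalkOfMem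
    {V W : Scheme.{u}} [IrreducibleSpace V] (f : V.PartialMap W) {x : V} (hx : x ∈ f.domain) :
    Spec.map (V.presheaf.stalkSpecializes ((genericPoint_spec V).specializes trivial)) ≫
      f.fromSpecStalkOfMem hx = f.fromFunctionField := by
  rw [fromFunctionField, fromSpecStalkOfMem, fromSpecStalkOfMem, ← Category.assoc]
  congr 1
  rw [← cancel_mono f.domain.ι]
  simp

/-- Every morphism over `K` from the generic point of a curve to a curve extends to the
whole curve. -/
theorem IsCurve.exists_hom_of_functionField [IsCurve X] [IsCurve Y]
    (t : Spec X.left.functionField ⟶ Y.left)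
    (ht : t ≫ Y.hom = X.left.fromSpecStalk (genericPoint X.left) ≫ X.hom) :
    ∃ f : X ⟶ Y, X.left.fromSpecStalk (genericPoint X.left) ≫ f.left = t := by
  let r := Scheme.RationalMap.ofFunctionField X.hom Y.hom t ht
  have hr : r.fromFunctionField = t :=
    Scheme.RationalMap.fromFunctionField_ofFunctionField X.hom Y.hom t ht
  -- The valuative criterion lifts t to the spectrum of the local ring at x. The lift spreads out to
  -- a neighbourhood of x and agrees with r at the generic point, so r is defined at x.
  have hdom : r.toPartialMap.domain = ⊤ := by
    refine top_le_iff.mp fun x _ => ?_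
    let j : Spec X.left.functionField ⟶ Spec (X.left.presheaf.stalk x) :=
      Spec.map (X.left.presheaf.stalkSpecializes
        ((genericPoint_spec X.left).specializes trivial))
    have hsq : CommSq t j Y.hom (X.left.fromSpecStalk x ≫ X.hom) :=
      ⟨by rw [ht, Scheme.SpecMap_stalkSpecializes_fromSpecStalk_assoc]⟩
    let S : ValuativeCommSq Y.hom :=
      { R := X.left.presheaf.stalk x
        commRing := inferInstance
        domain := inferInstanceAs (IsDomain (X.left.presheaf.stalk x))
        valuationRing := IsCurve.valuationRing_stalk x
        K := X.left.functionField
        field := inferInstance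
        algebra := inferInstanceAs (Algebra (X.left.presheaf.stalk x) X.left.functionField)
        isFractionRing :=
          inferInstanceAs (IsFractionRing (X.left.presheaf.stalk x) X.left.functionField)
        i₁ := t
        i₂ := X.left.fromSpecStalk x ≫ X.hom
        commSq := hsq }
    have hval : ValuativeCriterion.Existence Y.hom := by
      have hu : UniversallyClosed Y.hom := inferInstance
      rw [UniversallyClosed.eq_valuativeCriterion] at hu
      exact hu.1
    obtain ⟨⟨l, hl, hl'⟩⟩ := (hval S).exists_lift
    let g := Scheme.PartialMap.ofFromSpecStalk X.hom Y.hom l hl'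
    have hx : x ∈ g.domain := Scheme.PartialMap.mem_domain_ofFromSpecStalk ..
    refine Scheme.RationalMap.mem_domain.mpr ⟨g, hx, ?_⟩
    apply Scheme.RationalMap.eq_of_fromFunctionField_eq
    rw [hr, Scheme.RationalMap.fromFunctionField_toRationalMap,
      ← g.specMap_stalkSpecializes_fromSpecStalkOfMem hx,
      Scheme.PartialMap.fromSpecStalkOfMem_ofFromSpecStalk]
    exact hl
  have hp : r.toPartialMap.fromFunctionField = t := by
    rw [← Scheme.RationalMap.fromFunctionField_toRationalMap,
      Scheme.RationalMap.toRationalMap_toPartialMap, hr]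
  generalize r.toPartialMap = p at hdom hp
  obtain ⟨U, hU, f⟩ := p
  subst hdom
  have hf : X.left.fromSpecStalk (genericPoint X.left) ≫ X.left.topIso.inv ≫ f = t := by
    rw [← hp, Scheme.PartialMap.fromFunctionField, Scheme.PartialMap.fromSpecStalkOfMem,
      ← Category.assoc]
    congr 1
    rw [← cancel_mono (Scheme.Opens.ι _)]
    simp
  refine ⟨Over.homMk (X.left.topIso.inv ≫ f) ?_, hf⟩
  apply ext_of_isDominant (X.left.fromSpecStalk (genericPoint X.left))
  rw [← ht, ← hf]
  simp

theorem fromSpecStalk_genericPoint_comp_left [IsCurve X] [IsCurve Y] (f : X ⟶ Y)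
    [IsNonconstant f] :
    X.left.fromSpecStalk (genericPoint X.left) ≫ f.left =
      Spec.map (CommRingCat.ofHom (functionFieldMap f)) ≫
        Y.left.fromSpecStalk (genericPoint Y.left) := by
  rw [functionFieldMap, CommRingCat.ofHom_hom, Spec.map_comp, Category.assoc,
    Scheme.SpecMap_stalkSpecializes_fromSpecStalk, Scheme.SpecMap_stalkMap_fromSpecStalk]

/-- The homomorphism of function fields is characterized by the restriction to the
generic point. -/
theorem functionFieldMap_eq_of_fromSpecStalk_comp [IsCurve X] [IsCurve Y] (f : X ⟶ Y)
    [IsNonconstant f] (g : Y.left.functionField →+* X.left.functionField)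
    (h : X.left.fromSpecStalk (genericPoint X.left) ≫ f.left =
      Spec.map (CommRingCat.ofHom g) ≫ Y.left.fromSpecStalk (genericPoint Y.left)) :
    functionFieldMap f = g := by
  rw [fromSpecStalk_genericPoint_comp_left, cancel_mono] at h
  exact congrArg CommRingCat.Hom.hom (Spec.map_injective h)

theorem IsCurve.hom_ext_functionFieldMap [IsCurve X] [IsCurve Y] {f g : X ⟶ Y}
    [IsNonconstant f] [IsNonconstant g] (h : functionFieldMap f = functionFieldMap g) : f = g := by
  apply IsCurve.hom_ext
  rw [fromSpecStalk_genericPoint_comp_left, fromSpecStalk_genericPoint_comp_left, h]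

theorem functionFieldMap_comp [IsCurve X] [IsCurve Y] [IsCurve Z] (f : X ⟶ Y) (g : Y ⟶ Z)
    [IsNonconstant f] [IsNonconstant g] [IsNonconstant (f ≫ g)] :
    functionFieldMap (f ≫ g) = (functionFieldMap f).comp (functionFieldMap g) := by
  apply functionFieldMap_eq_of_fromSpecStalk_comp
  rw [Over.comp_left, ← Category.assoc, fromSpecStalk_genericPoint_comp_left, Category.assoc,
    fromSpecStalk_genericPoint_comp_left, ← Category.assoc, ← Spec.map_comp,
    CommRingCat.ofHom_comp]

theorem map_genericPoint [IsCurve X] [IsCurve Y] (f : X ⟶ Y) [IsNonconstant f] :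
    f.left (genericPoint X.left) = genericPoint Y.left :=
  ((map_genericPoint_specializes f).antisymm
    ((genericPoint_spec Y.left).specializes trivial)).eq

theorem IsCurve.nontrivial (X : Over (Spec (CommRingCat.of K))) [IsCurve X] :
    Nontrivial X.left := by
  by_contra h
  rw [not_nontrivial_iff_subsingleton] at h
  have := topologicalKrullDim_zero_of_discreteTopology X.left
  rw [IsCurve.one_dimensional] at this
  exact absurd this (by norm_num)

instance IsNonconstant.id [IsCurve X] : IsNonconstant (𝟙 X) where
  nonconstant := by
    rintro ⟨y, hy⟩
    have := IsCurve.nontrivial X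
    obtain ⟨z, hz⟩ := exists_ne y
    exact hz (hy z)

instance IsNonconstant.isDominant [IsCurve X] [IsCurve Y] (f : X ⟶ Y) [IsNonconstant f] :
    IsDominant f.left where
  denseRange := by
    refine Dense.mono (s₁ := {genericPoint Y.left}) ?_ ?_
    · rintro _ rfl
      exact ⟨_, map_genericPoint f⟩
    · rw [dense_iff_closure_eq]
      exact genericPoint_spec Y.left

/-- The image is dense, and closed by properness. -/
instance IsNonconstant.surjective [IsCurve X] [IsCurve Y] (f : X ⟶ Y) [IsNonconstant f] :
    Surjective f.left := by
  have : IsProper (f.left ≫ Y.hom) := by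
    rw [Over.w f]
    infer_instance
  have : IsProper f.left := IsProper.of_comp f.left Y.hom
  exact surjective_of_isDominant_of_isClosed_range _ f.left.isClosedMap.isClosed_range

instance IsNonconstant.comp [IsCurve X] [IsCurve Y] (f : X ⟶ Y) (g : Y ⟶ Z) [IsNonconstant f]
    [hg : IsNonconstant g] : IsNonconstant (f ≫ g) where
  nonconstant := by
    rintro ⟨z, hz⟩
    refine hg.nonconstant ⟨z, fun y => ?_⟩
    obtain ⟨x, rfl⟩ := f.left.surjective y
    exact hz x

theorem IsNonconstant.of_comp (f : X ⟶ Y) (g : Y ⟶ Z) [h : IsNonconstant (f ≫ g)] :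
    IsNonconstant f where
  nonconstant := by
    rintro ⟨y, hy⟩
    exact h.nonconstant ⟨g.left y, fun x => congrArg g.left (hy x)⟩

/-- A nonconstant morphism of curves is an epimorphism in the category of curves. -/
theorem IsNonconstant.cancel_left [IsCurve X] [IsCurve Y] [IsCurve Z] (f : X ⟶ Y)
    [IsNonconstant f] {g h : Y ⟶ Z} (H : f ≫ g = f ≫ h) : g = h := by
  ext1
  exact ext_of_isDominant f.left (congrArg CommaMorphism.left H)

/-! ### Descending automorphisms along a cover -/

/-- A morphism of affine schemes given by an extension of fields is dominant. -/
theorem isDominant_specMap_of_field {k L : CommRingCat.{u}} (hk : IsField k) [Nontrivial L]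
    (i : k ⟶ L) : IsDominant (Spec.map i) where
  denseRange := by
    have : Subsingleton (Spec k) := by
      let := hk.toField
      exact inferInstanceAs (Subsingleton (PrimeSpectrum k))
    obtain ⟨z⟩ : Nonempty (PrimeSpectrum L) := inferInstance
    exact fun y => subset_closure ⟨z, Subsingleton.elim _ _⟩

/-- An endomorphism `μ` of `X` whose action on `K(X)` preserves `K(Y)` descends to `Y`. -/
theorem exists_comp_eq_of_functionFieldMap_range [IsCurve X] [IsCurve Y] (f : X ⟶ Y)
    [IsNonconstant f] (μ : X ⟶ X) [IsNonconstant μ]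
    (h : ∀ y, functionFieldMap μ (functionFieldMap f y) ∈ (functionFieldMap f).fieldRange) :
    ∃ ν : Y ⟶ Y, f ≫ ν = μ ≫ f := by
  let e : Y.left.functionField ≃+* (functionFieldMap f).fieldRange :=
    RingEquiv.ofBijective (functionFieldMap f).rangeRestrictField
      ⟨(functionFieldMap f).rangeRestrictField.injective,
        fun ⟨_, y, hy⟩ => ⟨y, Subtype.ext hy⟩⟩
  -- The restriction of μ* to K(Y), transported back along K(Y) ≅ f*K(Y).
  let τ : Y.left.functionField →+* Y.left.functionField :=
    (e.symm : (functionFieldMap f).fieldRange →+* Y.left.functionField).comp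
      (((functionFieldMap μ).comp (functionFieldMap f)).codRestrict _ h)
  have hτ : (functionFieldMap f).comp τ = (functionFieldMap μ).comp (functionFieldMap f) := by
    ext y
    exact congrArg Subtype.val (e.apply_symm_apply
      ((((functionFieldMap μ).comp (functionFieldMap f)).codRestrict _ h) y))
  have hdom : IsDominant (Spec.map (CommRingCat.ofHom (functionFieldMap f))) :=
    isDominant_specMap_of_field (Field.toIsField Y.left.functionField) _
  obtain ⟨t, ht⟩ : ∃ t : Spec Y.left.functionField ⟶ Y.left,
      Spec.map (CommRingCat.ofHom (functionFieldMap f)) ≫ t =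
        X.left.fromSpecStalk (genericPoint X.left) ≫ (μ ≫ f).left := by
    obtain ⟨τ', hτ'⟩ : ∃ τ' : Y.left.functionField ⟶ Y.left.functionField,
        τ' ≫ CommRingCat.ofHom (functionFieldMap f) =
          CommRingCat.ofHom (functionFieldMap (μ ≫ f)) :=
      ⟨CommRingCat.ofHom τ, by
        rw [functionFieldMap_comp, ← hτ]
        rfl⟩
    refine ⟨Spec.map τ' ≫ Y.left.fromSpecStalk (genericPoint Y.left), ?_⟩
    rw [fromSpecStalk_genericPoint_comp_left, ← hτ']
    exact (Spec.map_comp_assoc τ' (CommRingCat.ofHom (functionFieldMap f)) _).symm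
  obtain ⟨ν, hν⟩ := IsCurve.exists_hom_of_functionField t (by
    -- Compatibility with the structure maps to Spec K may be tested after pulling back to Spec
    -- K(X).
    apply ext_of_isDominant (Spec.map (CommRingCat.ofHom (functionFieldMap f)))
    rw [← Category.assoc, ht, ← Category.assoc (Spec.map _),
      ← fromSpecStalk_genericPoint_comp_left]
    simp)
  refine ⟨ν, IsCurve.hom_ext ?_⟩
  rw [← ht, Over.comp_left, ← Category.assoc, fromSpecStalk_genericPoint_comp_left,
    Category.assoc, hν]

/-- If the monodromy group of a composite cover `h ∘ f` has a transitive Dedekind subgroup, then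
every endomorphism of `h ∘ f` descends along `f`. -/
theorem MonHasTransitiveDedekindSubgroup.exists_comp_eq [IsCurve X] [IsCurve Y] [IsCurve Z]
    (f : X ⟶ Y) (h : Y ⟶ Z) [IsNonconstant f] [IsNonconstant h] [IsCover (f ≫ h)]
    (hMon : MonHasTransitiveDedekindSubgroup (f ≫ h)) {μ : X ⟶ X}
    (hμ : μ ≫ f ≫ h = f ≫ h) : ∃ ν : Y ⟶ Y, f ≫ ν = μ ≫ f := by
  have : IsNonconstant (μ ≫ f ≫ h) := by
    rw [hμ]
    infer_instance
  have : IsNonconstant μ := .of_comp μ (f ≫ h)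
  apply exists_comp_eq_of_functionFieldMap_range
  intro y
  let := functionFieldAlgebra (f ≫ h)
  have : Algebra.IsSeparable Z.left.functionField X.left.functionField :=
    IsCover.separable (f := f ≫ h)
  let M : IntermediateField Z.left.functionField X.left.functionField :=
    (functionFieldMap f).fieldRange.toIntermediateField fun z =>
      ⟨functionFieldMap h z, (RingHom.congr_fun (functionFieldMap_comp f h) z).symm⟩
  let σ : X.left.functionField →ₐ[Z.left.functionField] X.left.functionField :=
    { functionFieldMap μ with
      commutes' := fun z => by
        change functionFieldMap μ (functionFieldMap (f ≫ h) z) = functionFieldMap (f ≫ h) z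
        rw [← RingHom.comp_apply, ← functionFieldMap_comp]
        simp only [hμ] }
  exact GaloisClosureGroup.HasTransitiveDedekindSubgroup.map_mem hMon M σ
    (show functionFieldMap f y ∈ M from ⟨y, rfl⟩)

/-! ### Automorphism groups of covers -/

theorem coverAut_le_coverAut_comp (f : X ⟶ Y) (g : Y ⟶ Z) : coverAut f ≤ coverAut (f ≫ g) := by
  intro μ hμ
  change μ.hom ≫ f ≫ g = f ≫ g
  rw [← Category.assoc, show μ.hom ≫ f = f from hμ]

/-- If every automorphism of `g ∘ f` descends along `f`, then there is a homomorphism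
`Aut(g ∘ f) → Aut(g)` with kernel `Aut(f)`. -/
theorem exists_coverAut_hom [IsCurve X] [IsCurve Y] [IsCurve Z] (f : X ⟶ Y) (g : Y ⟶ Z)
    [IsNonconstant f] (H : ∀ μ ∈ coverAut (f ≫ g), ∃ ν : Y ⟶ Y, f ≫ ν = μ.hom ≫ f) :
    ∃ ρ : coverAut (f ≫ g) →* coverAut g, ρ.ker = (coverAut f).subgroupOf (coverAut (f ≫ g)) := by
  have H' (μ : coverAut (f ≫ g)) : ∃ ν : coverAut g, f ≫ ν.1.hom = μ.1.hom ≫ f := by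
    obtain ⟨ν, hν⟩ := H μ.1 μ.2
    -- The inverse descends too; cancelling the epimorphism f makes the two descents mutually
    -- inverse.
    obtain ⟨ν', hν'⟩ := H _ (inv_mem μ.2)
    replace hν' : f ≫ ν' = μ.1.inv ≫ f := hν'
    refine ⟨⟨⟨ν, ν', ?_, ?_⟩, ?_⟩, hν⟩
    · apply IsNonconstant.cancel_left f
      rw [← Category.assoc, hν, Category.assoc, hν', Category.comp_id]
      exact Iso.hom_inv_id_assoc (show X ≅ X from μ.1) f
    · apply IsNonconstant.cancel_left f
      rw [← Category.assoc, hν', Category.assoc, hν, Category.comp_id]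
      exact Iso.inv_hom_id_assoc (show X ≅ X from μ.1) f
    · apply IsNonconstant.cancel_left f
      rw [← Category.assoc, hν, Category.assoc]
      exact μ.2
  choose r hr using H'
  have hext {ν ν' : coverAut g} (h : f ≫ ν.1.hom = f ≫ ν'.1.hom) : ν = ν' :=
    Subtype.ext (Iso.ext (IsNonconstant.cancel_left f h))
  refine ⟨MonoidHom.mk' r fun μ μ' => hext ?_, ?_⟩
  · rw [hr]
    -- The product `μ * μ'` in `Aut` is `μ'.hom ≫ μ.hom`.
    calc (μ'.1.hom ≫ μ.1.hom) ≫ f = μ'.1.hom ≫ f ≫ (r μ).1.hom := by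
          rw [hr, Category.assoc]
      _ = f ≫ (r μ').1.hom ≫ (r μ).1.hom := by
          rw [← Category.assoc, ← hr, Category.assoc]
  · ext μ
    rw [MonoidHom.mem_ker, Subgroup.mem_subgroupOf]
    change r μ = 1 ↔ μ.1.hom ≫ f = f
    rw [← hr]
    constructor
    · intro h
      rw [h]
      exact Category.comp_id f
    · intro h
      exact hext (h.trans (Category.comp_id f).symm)

/-- The automorphism group of a cover of finite degree is finite. -/
theorem finite_coverAut [IsCurve X] [IsCurve Y] (f : X ⟶ Y) [IsNonconstant f]
    (hf : coverDegree f ≠ 0) : Finite (coverAut f) := by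
  let := functionFieldAlgebra f
  -- `finrank` is 0 for infinite extensions, so nonzero degree means finite degree.
  have : FiniteDimensional Y.left.functionField X.left.functionField :=
    Module.finite_of_finrank_pos (Nat.pos_of_ne_zero hf)
  have hnc (μ : coverAut f) : IsNonconstant μ.1.hom := by
    have : IsNonconstant (μ.1.hom ≫ f) := by
      rw [show μ.1.hom ≫ f = f from μ.2]
      infer_instance
    exact .of_comp μ.1.hom f
  refine Finite.of_injective (β := X.left.functionField →ₐ[Y.left.functionField]
    X.left.functionField) (fun μ => { functionFieldMap μ.1.hom with
      commutes' := fun y => by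
        change functionFieldMap μ.1.hom (functionFieldMap f y) = functionFieldMap f y
        rw [← RingHom.comp_apply, ← functionFieldMap_comp]
        simp only [show μ.1.hom ≫ f = f from μ.2] }) fun μ μ' h => ?_
  refine Subtype.ext (Iso.ext (IsCurve.hom_ext_functionFieldMap (RingHom.ext fun x => ?_)))
  exact DFunLike.congr_fun h x

/-! ### Chains of covers -/

section Chain

variable {n : ℕ} {C : Fin (n + 1) → Over (Spec (CommRingCat.of K))}
  (φ : ∀ i : Fin n, C i.castSucc ⟶ C i.succ)

theorem partialComp_succ (i : Fin n) :
    partialComp φ i.succ = partialComp φ i.castSucc ≫ φ i :=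
  Fin.induction_succ ..

variable [∀ i, IsCurve (C i)] [∀ i, IsNonconstant (φ i)]

instance isNonconstant_partialComp (i : Fin (n + 1)) : IsNonconstant (partialComp φ i) := by
  induction i using Fin.induction with
  | zero => exact IsNonconstant.id
  | succ i _ =>
    rw [partialComp_succ]
    infer_instance

/-- Supplies the remaining map C_i → D, through which automorphisms of a partial composite become
automorphisms of the whole cover. -/
theorem exists_partialComp_comp_eq_last (i : Fin (n + 1)) :
    ∃ r : C i ⟶ C (Fin.last n), IsNonconstant r ∧
      partialComp φ i ≫ r = partialComp φ (Fin.last n) := by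
  induction i using Fin.reverseInduction with
  | last => exact ⟨𝟙 _, inferInstance, Category.comp_id _⟩
  | cast i ih =>
    obtain ⟨r, hr, h⟩ := ih
    refine ⟨φ i ≫ r, inferInstance, ?_⟩
    rw [← Category.assoc, ← partialComp_succ, h]

end Chain

end

/-! ### The theorem for a chain of covers -/

theorem theorem7p1 {K : Type u} [Field K] {n : ℕ}
    (C : Fin (n + 1) → Over (Spec (CommRingCat.of K))) [∀ i, IsCurve (C i)]
    (Φ : C 0 ⟶ C (Fin.last n)) [IsCover Φ]
    (hMon : MonHasTransitiveDedekindSubgroup Φ)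
    (φ : ∀ i : Fin n, C i.castSucc ⟶ C i.succ) [∀ i, IsCover (φ i)]
    (hdeg : ∀ i, 2 ≤ coverDegree (φ i))
    (hΦ : Φ = partialComp φ (Fin.last n)) :
    (∀ i : Fin n,
      coverAut (partialComp φ i.castSucc) ≤ coverAut (partialComp φ i.succ) ∧
      ∃ _ : ((coverAut (partialComp φ i.castSucc)).subgroupOf
          (coverAut (partialComp φ i.succ))).Normal,
        ∃ B : Subgroup (coverAut (φ i)),
          Nonempty ((coverAut (partialComp φ i.succ) ⧸
            (coverAut (partialComp φ i.castSucc)).subgroupOf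
              (coverAut (partialComp φ i.succ))) ≃* B)) ∧
    Finite (coverAut Φ) ∧ (∀ i, Finite (coverAut (φ i))) ∧
    Nat.card (coverAut Φ) ∣ ∏ i, Nat.card (coverAut (φ i)) := by
  subst hΦ
  have hle (i : Fin n) :
      coverAut (partialComp φ i.castSucc) ≤ coverAut (partialComp φ i.succ) := by
    rw [partialComp_succ]
    exact coverAut_le_coverAut_comp _ _
  have hker (i : Fin n) : ∃ ρ : coverAut (partialComp φ i.succ) →* coverAut (φ i),
      ρ.ker = (coverAut (partialComp φ i.castSucc)).subgroupOf
        (coverAut (partialComp φ i.succ)) := by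
    obtain ⟨r, hr, hlast⟩ := exists_partialComp_comp_eq_last φ i.succ
    rw [partialComp_succ, Category.assoc] at hlast
    rw [partialComp_succ]
    refine exists_coverAut_hom _ _ fun μ hμ => ?_
    have hcover : IsCover (partialComp φ i.castSucc ≫ φ i ≫ r) := by
      rw [hlast]
      infer_instance
    refine MonHasTransitiveDedekindSubgroup.exists_comp_eq _ (φ i ≫ r) ?_ ?_
    · simp only [hlast]
      exact hMon
    · rw [← Category.assoc (partialComp φ i.castSucc), ← Category.assoc,
        show μ.hom ≫ partialComp φ i.castSucc ≫ φ i = _ from hμ]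
  have hfin (i : Fin n) : Finite (coverAut (φ i)) :=
    finite_coverAut (φ i) (by have := hdeg i; omega)
  have hcard (i : Fin (n + 1)) : Finite (coverAut (partialComp φ i)) ∧
      Nat.card (coverAut (partialComp φ i)) ∣
        ∏ j with Fin.castSucc j < i, Nat.card (coverAut (φ j)) := by
    induction i using Fin.induction with
    | zero =>
      have : Subsingleton (coverAut (partialComp φ 0)) := by
        refine ⟨fun μ μ' => Subtype.ext (Iso.ext ?_)⟩
        have h (μ : coverAut (partialComp φ 0)) : μ.1.hom = 𝟙 (C 0) :=
          (Category.comp_id _).symm.trans μ.2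
        rw [h μ, h μ']
      exact ⟨inferInstance, by simp⟩
    | succ i ih =>
      obtain ⟨hfi, hdvd⟩ := ih
      obtain ⟨ρ, hρ⟩ := hker i
      have hN : Nat.card ρ.ker = Nat.card (coverAut (partialComp φ i.castSucc)) := by
        rw [hρ]
        exact Nat.card_congr (Subgroup.subgroupOfEquivOfLe (hle i)).toEquiv
      have hG : Nat.card (coverAut (partialComp φ i.succ)) =
          Nat.card ρ.range * Nat.card (coverAut (partialComp φ i.castSucc)) := by
        rw [← hN, Subgroup.card_eq_card_quotient_mul_card_subgroup ρ.ker,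
          Nat.card_congr (QuotientGroup.quotientKerEquivRange ρ).toEquiv]
      have hfilter : Finset.univ.filter (fun j : Fin n => j.castSucc < i.succ) =
          insert i (Finset.univ.filter fun j : Fin n => j.castSucc < i.castSucc) := by
        ext j
        simp [Fin.castSucc_lt_succ_iff, le_iff_eq_or_lt]
      -- `Nat.card` is 0 on infinite types, so the nonzero product of the orders of image and kernel
      -- proves finiteness.
      refine ⟨Nat.finite_of_card_ne_zero ?_, ?_⟩
      · rw [hG]
        exact mul_ne_zero Nat.card_pos.ne' Nat.card_pos.ne'
      · rw [hG, hfilter, Finset.prod_insert (by simp)]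
        exact mul_dvd_mul (Subgroup.card_subgroup_dvd_card _) hdvd
  refine ⟨fun i => ⟨hle i, ?_⟩, (hcard _).1, hfin, ?_⟩
  · obtain ⟨ρ, hρ⟩ := hker i
    rw [← hρ]
    exact ⟨inferInstance, ρ.range, ⟨QuotientGroup.quotientKerEquivRange ρ⟩⟩
  · have h := (hcard (Fin.last n)).2
    rwa [Finset.filter_true_of_mem fun j _ => Fin.castSucc_lt_last j] at h
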